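/- Let $X$ be a real Hilbert space and let $A,B\colon X\rightrightarrows X$ be maximally monotone operators. Write $\operatorname{dom}A=\{x\in X : Ax\neq\varnothing\}$ and $\operatorname{ran}A=\bigcup_{x\in X}Ax$, let $J_A=(\mathrm{Id}+A)^{-1}$ and $R_A=2J_A-\mathrm{Id}$ be the resolvent and the reflected resolvent of $A$ (similarly for $B$ and $A^{-1}$), and let $T=\mathrm{Id}-J_A+J_BR_A$ be the Douglas--Rachford operator. Set $D=\operatorname{dom}A-\operatorname{dom}B$ and $R=\operatorname{ran}A+\operatorname{ran}B$. The sets $\overline{D}$ and $\overline{R}$ are nonempty, closed and convex; let $v_D=P_{\overline{D}}(0)$ and $v_R=P_{\overline{R}}(0)$ be the projections of $0$ onto them. Assume that $$\overline{\operatorname{ran}}(\mathrm{Id}-T)=\overline{D\cap R}=\overline{D}\cap\overline{R}.$$ Call a sequence $(y_n)_{n\in\mathbb{N}}$ in $X$ asymptotically regular if $y_n-y_{n+1}\to 0$ in norm. Then for every $x\in X$: (i) $(J_AT^nx)_{n\in\mathbb{N}}$ is asymptotically regular if and only if $v_R=0$; (ii) $(J_{A^{-1}}T^nx)_{n\in\mathbb{N}}$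 is asymptotically regular if and only if $v_D=0$. -/

import Mathlib

open Filter Topology Set
open scoped Pointwise

namespace DouglasRachford

section

variable {X : Type*} [NormedAddCommGroup X] [InnerProductSpace ℝ X]

/-- A set-valued operator `A : X ⇉ X`, identified with its graph (`(x, u) ∈ A` means `u ∈ A x`),
is monotone if `⟪x - y, u - w⟫ ≥ 0` whenever `u ∈ A x` and `w ∈ A y`.
Its domain, range and inverse are `A.dom`, `A.cod` and `A.inv`. -/
def IsMonotone (A : SetRel X X) : Prop :=
  ∀ x u y w : X, (x, u) ∈ A → (y, w) ∈ A → 0 ≤ inner ℝ (x - y) (u - w)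

/-- Monotone, and the graph has no proper monotone extension. -/
def IsMaximallyMonotone (A : SetRel X X) : Prop :=
  Maximal IsMonotone A

/-- The set-valued operator `Id + A`, that is `x ↦ {x + a | a ∈ A x}`. -/
def idAdd (A : SetRel X X) : SetRel X X :=
  {q | ∃ a, (q.1, a) ∈ A ∧ q.2 = q.1 + a}

open Classical in
/-- The resolvent `J_A = (Id + A)⁻¹` as a map `X → X`: the point `J_A x` is the point `p` with
`x ∈ p + A p`. If `A` is monotone, there is at most one such `p` (see `resolvent_eq`); if `A` is
maximally monotone on a Hilbert space, there is one for each `x`, by Minty's theorem. The value `0`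
where there is none is a convention that is never used for maximally monotone operators. -/
noncomputable def resolvent (A : SetRel X X) (x : X) : X :=
  if h : ∃ p, (x, p) ∈ (idAdd A).inv then h.choose else 0

theorem mem_inv_idAdd_iff {A : SetRel X X} {x p : X} :
    (x, p) ∈ (idAdd A).inv ↔ (p, x - p) ∈ A := by
  constructor
  · rintro ⟨a, ha, h⟩
    have h' : x = p + a := h
    simpa [h'] using ha
  · intro h
    exact ⟨x - p, h, by simp⟩

theorem resolvent_eq {A : SetRel X X} (hA : IsMonotone A) {x p : X} (hp : (p, x - p) ∈ A) :
    resolvent A x = p := by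
  have h : ∃ p, (x, p) ∈ (idAdd A).inv := ⟨p, mem_inv_idAdd_iff.2 hp⟩
  have hq : (resolvent A x, x - resolvent A x) ∈ A := by
    rw [resolvent, dif_pos h]
    exact mem_inv_idAdd_iff.1 h.choose_spec
  have key := hA _ _ _ _ hq hp
  have e : (x - resolvent A x) - (x - p) = -(resolvent A x - p) := by abel
  rw [e, inner_neg_right, real_inner_self_eq_norm_sq] at key
  have : ‖resolvent A x - p‖ = 0 := by nlinarith [norm_nonneg (resolvent A x - p)]
  exact sub_eq_zero.1 (norm_eq_zero.1 this)

/-- The reflected resolvent `R_A = 2 J_A - Id`. -/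
noncomputable def reflectedResolvent (A : SetRel X X) (x : X) : X :=
  (2 : ℝ) • resolvent A x - x

/-- The Douglas–Rachford operator `T = Id - J_A + J_B R_A`. -/
noncomputable def drOperator (A B : SetRel X X) (x : X) : X :=
  x - resolvent A x + resolvent B (reflectedResolvent A x)

open Classical in
/-- The projection `P_C x`, that is, the nearest point to `x` in `C`. It exists and is unique if
`C` is a nonempty closed convex subset of a Hilbert space (see `metricProj_spec` and
`metricProj_eq`). The value `0` where there is no nearest point is a convention. -/
noncomputable def metricProj (C : Set X) (x : X) : X :=
  if h : ∃ p ∈ C, ∀ q ∈ C, ‖x - p‖ ≤ ‖x - q‖ then h.choose else 0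

theorem metricProj_spec [CompleteSpace X] {C : Set X} (hne : C.Nonempty) (hcl : IsClosed C)
    (hco : Convex ℝ C) (x : X) :
    metricProj C x ∈ C ∧ ∀ q ∈ C, ‖x - metricProj C x‖ ≤ ‖x - q‖ := by
  have h : ∃ p ∈ C, ∀ q ∈ C, ‖x - p‖ ≤ ‖x - q‖ := by
    obtain ⟨p, hp, hmin⟩ := exists_norm_eq_iInf_of_complete_convex hne hcl.isComplete hco x
    refine ⟨p, hp, fun q hq => ?_⟩
    rw [hmin]
    exact ciInf_le ⟨0, by rintro _ ⟨w, rfl⟩; exact norm_nonneg _⟩ (⟨q, hq⟩ : C)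
  rw [metricProj, dif_pos h]
  exact h.choose_spec

theorem metricProj_eq {C : Set X} (hco : Convex ℝ C) {x p : X} (hp : p ∈ C)
    (hmin : ∀ q ∈ C, ‖x - p‖ ≤ ‖x - q‖) : metricProj C x = p := by
  have h : ∃ p ∈ C, ∀ q ∈ C, ‖x - p‖ ≤ ‖x - q‖ := ⟨p, hp, hmin⟩
  obtain ⟨hq, hqmin⟩ : metricProj C x ∈ C ∧ ∀ q ∈ C, ‖x - metricProj C x‖ ≤ ‖x - q‖ := by
    rw [metricProj, dif_pos h]
    exact h.choose_spec
  set r := metricProj C x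
  have hm : (1 / 2 : ℝ) • r + (1 / 2 : ℝ) • p ∈ C :=
    hco hq hp (by norm_num) (by norm_num) (by norm_num)
  have e1 : ‖x - r‖ = ‖x - p‖ := le_antisymm (hqmin p hp) (hmin r hq)
  have e2 := hmin _ hm
  have e3 := parallelogram_law_with_norm ℝ (x - r) (x - p)
  have e4 : (x - r) + (x - p) = (2 : ℝ) • (x - ((1 / 2 : ℝ) • r + (1 / 2 : ℝ) • p)) := by
    module
  have e5 : (x - r) - (x - p) = p - r := by abel
  rw [e4, e5, norm_smul, e1, Real.norm_eq_abs, abs_of_pos (by norm_num : (0 : ℝ) < 2)] at e3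
  have : ‖p - r‖ = 0 := by nlinarith [norm_nonneg (p - r), norm_nonneg (x - p)]
  exact (sub_eq_zero.1 (norm_eq_zero.1 this)).symm

/-- `D = dom A - dom B`. -/
def domDiff (A B : SetRel X X) : Set X :=
  A.dom - B.dom

/-- `R = ran A + ran B`. -/
def ranSum (A B : SetRel X X) : Set X :=
  A.cod + B.cod

/-- `v_D`, the projection of `0` onto the closure of `dom A - dom B`. -/
noncomputable def vD (A B : SetRel X X) : X :=
  metricProj (closure (domDiff A B)) 0

/-- `v_R`, the projection of `0` onto the closure of `ran A + ran B`. -/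
noncomputable def vR (A B : SetRel X X) : X :=
  metricProj (closure (ranSum A B)) 0

/-- A sequence `(y_n)` is asymptotically regular if `y_n - y_{n+1} → 0` in norm. -/
def AsymptoticallyRegular (y : ℕ → X) : Prop :=
  Tendsto (fun n => y n - y (n + 1)) atTop (𝓝 0)

end

end DouglasRachford

/-! Put `z n = T^n x` and `a n = J_A (z n)`, so that `J_{A⁻¹} (z n) = z n - a n`. The differences of
`a n` tend to `v_R` and those of `z n - a n` to `v_D` (`tendsto_resolvent_iterate_sub`); both
equivalences then follow from uniqueness of limits.

A direction bounded below on the domain of an operator gives a recession direction of the closure of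
its range. Applied to `v_D`, and through inverses to `v_R`, this shows `v_R ⊥ v_D` and that `v_R +
v_D` is the element of minimal norm of `closure D ∩ closure R`, which is the closure of `ran (Id -
T)`. As `T` is firmly nonexpansive, `z n - z (n + 1) → v_R + v_D`. Split this difference as `p + s`,
with `p` from `a` and `s` from `z - a`. Then `⟪p, s⟫`, `⟪v_D, p⟫` and `⟪v_R, s⟫` tend to `0`, and
expanding `‖p - v_R‖² + ‖s - v_D‖²` shows that it vanishes in the limit. -/

namespace DouglasRachford

section

variable {X : Type*} [NormedAddCommGroup X] [InnerProductSpace ℝ X]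

/-! ### Minty's theorem and resolvents. -/

/-- The function `(h, r) ↦ r + ‖h‖² / 2` attains its minimum on a nonempty closed convex set on
which it is nonnegative; this is the first-order condition at the minimizer. -/
theorem exists_forall_sub_inner_le [CompleteSpace X] {E : Set (X × ℝ)} (hne : E.Nonempty)
    (hcl : IsClosed E) (hco : Convex ℝ E) (hpos : ∀ e ∈ E, 0 ≤ e.2 + ‖e.1‖ ^ 2 / 2) :
    ∃ e ∈ E, ∀ e' ∈ E, e.2 - inner ℝ e.1 (e'.1 - e.1) ≤ e'.2 := by
  set g : X × ℝ → ℝ := fun e => e.2 + ‖e.1‖ ^ 2 / 2 with hg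
  have hbdd : BddBelow (g '' E) := ⟨0, by rintro _ ⟨e, he, rfl⟩; exact hpos e he⟩
  set m := sInf (g '' E) with hm
  have hmle : ∀ e ∈ E, m ≤ g e := fun e he => csInf_le hbdd ⟨e, he, rfl⟩
  have hseq : ∀ n : ℕ, ∃ e ∈ E, g e < m + 1 / ((n : ℝ) + 1) := by
    intro n
    obtain ⟨_, ⟨e, he, rfl⟩, hlt⟩ := exists_lt_of_csInf_lt (hne.image g)
      (lt_add_of_pos_right m (Nat.one_div_pos_of_nat (α := ℝ) (n := n)))
    exact ⟨e, he, hlt⟩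
  choose s hsE hs using hseq
  -- Strong convexity in the first coordinate makes a minimizing sequence Cauchy there; the second
  -- coordinate is then recovered from the value of `g`.
  have hdist : ∀ e ∈ E, ∀ e' ∈ E, ‖e.1 - e'.1‖ ^ 2 ≤ 4 * (g e - m) + 4 * (g e' - m) := by
    intro e he e' he'
    have h1 := hmle _ (hco he he' (by norm_num : (0 : ℝ) ≤ 1 / 2) (by norm_num : (0 : ℝ) ≤ 1 / 2)
      (by norm_num))
    have h2 := parallelogram_law_with_norm ℝ e.1 e'.1
    have h3 : ‖(1 / 2 : ℝ) • e.1 + (1 / 2 : ℝ) • e'.1‖ = 1 / 2 * ‖e.1 + e'.1‖ := by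
      rw [← smul_add, norm_smul]; norm_num
    simp only [hg, Prod.fst_add, Prod.snd_add, Prod.smul_fst, Prod.smul_snd, smul_eq_mul] at h1 ⊢
    rw [h3] at h1
    nlinarith
  have hcau : CauchySeq fun n => (s n).1 := by
    refine cauchySeq_of_le_tendsto_0' (fun n : ℕ => √(8 * (1 / ((n : ℝ) + 1)))) ?_ ?_
    · intro n k hnk
      rw [dist_eq_norm]
      refine Real.le_sqrt_of_sq_le ((hdist _ (hsE n) _ (hsE k)).trans ?_)
      have h1 := hs n
      have h2 := hs k
      have h3 : 1 / ((k : ℝ) + 1) ≤ 1 / ((n : ℝ) + 1) := Nat.one_div_le_one_div hnk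
      linarith
    · have h := (tendsto_one_div_add_atTop_nhds_zero_nat (𝕜 := ℝ)).const_mul 8
      simpa using h.sqrt
  obtain ⟨h, hh⟩ := cauchySeq_tendsto_of_complete hcau
  have hgm : Tendsto (fun n => g (s n)) atTop (𝓝 m) := by
    refine tendsto_of_tendsto_of_tendsto_of_le_of_le tendsto_const_nhds ?_
      (fun n => hmle _ (hsE n)) (fun n => (hs n).le)
    simpa using (tendsto_one_div_add_atTop_nhds_zero_nat (𝕜 := ℝ)).const_add m
  have hr : Tendsto (fun n => (s n).2) atTop (𝓝 (m - ‖h‖ ^ 2 / 2)) := by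
    have := hgm.sub ((hh.norm.pow 2).div_const 2)
    simpa [hg] using this
  have hmem : (h, m - ‖h‖ ^ 2 / 2) ∈ E :=
    hcl.mem_of_tendsto (hh.prodMk_nhds hr) (Eventually.of_forall hsE)
  refine ⟨_, hmem, fun e' he' => ?_⟩
  have key : ∀ t : ℝ, 0 < t → t ≤ 1 →
      0 ≤ e'.2 - (m - ‖h‖ ^ 2 / 2) + inner ℝ h (e'.1 - h) + t * (‖e'.1 - h‖ ^ 2 / 2) := by
    intro t ht ht1
    have h1 := hmle _ (hco hmem he' (sub_nonneg.2 ht1) ht.le (by ring))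
    have h2 : (1 - t) • h + t • e'.1 = h + t • (e'.1 - h) := by module
    simp only [hg, Prod.fst_add, Prod.snd_add, Prod.smul_fst, Prod.smul_snd, smul_eq_mul] at h1
    rw [h2, norm_add_sq_real, inner_smul_right, norm_smul, Real.norm_of_nonneg ht.le] at h1
    refine nonneg_of_mul_nonneg_right (a := t) ?_ ht
    nlinarith
  have hlim : Tendsto (fun t : ℝ => e'.2 - (m - ‖h‖ ^ 2 / 2) + inner ℝ h (e'.1 - h) +
      t * (‖e'.1 - h‖ ^ 2 / 2)) (𝓝[>] 0)
      (𝓝 (e'.2 - (m - ‖h‖ ^ 2 / 2) + inner ℝ h (e'.1 - h) + 0 * (‖e'.1 - h‖ ^ 2 / 2))) :=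
    Tendsto.mono_left (Continuous.tendsto (by fun_prop) 0) nhdsWithin_le_nhds
  have := ge_of_tendsto hlim (by
    filter_upwards [Ioc_mem_nhdsGT (zero_lt_one (α := ℝ))] with t ht using key t ht.1 ht.2)
  simp only
  linarith

/-- Adjoining such a point to the graph keeps it monotone, so maximality absorbs it. -/
theorem IsMaximallyMonotone.mem_of_forall_nonneg {A : SetRel X X} (hA : IsMaximallyMonotone A)
    {x u : X} (h : ∀ y w, (y, w) ∈ A → 0 ≤ inner ℝ (x - y) (u - w)) : (x, u) ∈ A := by
  refine hA.mem_of_prop_insert (x := (x, u)) ?_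
  intro a b c d hab hcd
  rcases hab with hab | hab <;> rcases hcd with hcd | hcd
  · cases hab; cases hcd; simp
  · cases hab; exact h _ _ hcd
  · cases hcd
    have := h _ _ hab
    rwa [← neg_sub x a, ← neg_sub u b, inner_neg_neg]
  · exact hA.prop _ _ _ _ hab hcd

theorem IsMaximallyMonotone.nonempty {A : SetRel X X} (hA : IsMaximallyMonotone A) :
    ∃ a b, (a, b) ∈ A := by
  by_contra! h
  exact h 0 0 (hA.mem_of_forall_nonneg fun y w hyw => absurd hyw (h y w))

theorem IsMonotone.inv {A : SetRel X X} (hA : IsMonotone A) : IsMonotone A.inv := by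
  intro x u y w h1 h2
  rw [real_inner_comm]
  exact hA _ _ _ _ h1 h2

theorem IsMaximallyMonotone.inv {A : SetRel X X} (hA : IsMaximallyMonotone A) :
    IsMaximallyMonotone A.inv := by
  refine ⟨IsMonotone.inv hA.prop, fun S hS hAS => ?_⟩
  rintro ⟨x, u⟩ hxu
  refine hA.mem_of_forall_nonneg fun y w hyw => ?_
  rw [real_inner_comm]
  exact hS _ _ _ _ hxu (hAS (show (w, y) ∈ A.inv from hyw))

/-- Minty's theorem at the origin: the graph of a maximally monotone operator meets the
antidiagonal. -/
theorem exists_neg_mem_of_maximal [CompleteSpace X] {A : Set (X × X)} (hne : A.Nonempty)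
    (hmono : ∀ p ∈ A, ∀ q ∈ A, 0 ≤ inner ℝ (p.1 - q.1) (p.2 - q.2))
    (hmax : ∀ p : X × X, (∀ q ∈ A, 0 ≤ inner ℝ (p.1 - q.1) (p.2 - q.2)) → p ∈ A) :
    ∃ x, (x, -x) ∈ A := by
  set F : WithLp 2 (X × X) → X × X → ℝ :=
    fun h q => inner ℝ h.fst q.2 + inner ℝ q.1 h.snd - inner ℝ q.1 q.2 with hF
  -- The epigraph of the Fitzpatrick function of `A`, the supremum of `F · q` over `q ∈ A`.
  set E : Set (WithLp 2 (X × X) × ℝ) := {e | ∀ q ∈ A, F e.1 q ≤ e.2} with hE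
  have hself : ∀ p ∈ A, (WithLp.toLp 2 p, inner ℝ p.1 p.2) ∈ E := by
    intro p hp q hq
    have := hmono p hp q hq
    simp only [inner_sub_left, inner_sub_right] at this
    simp only [hF, WithLp.toLp_fst, WithLp.toLp_snd]
    linarith
  have hEne : E.Nonempty := hne.elim fun p hp => ⟨_, hself p hp⟩
  have hEcl : IsClosed E := by
    have : E = ⋂ q ∈ A, {e | F e.1 q ≤ e.2} := by ext; simp [hE]
    rw [this]
    refine isClosed_biInter fun q _ => isClosed_le ?_ continuous_snd
    simp only [hF]
    fun_prop
  have hEco : Convex ℝ E := by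
    intro e he e' he' s t hs ht hst q hq
    have h1 := mul_le_mul_of_nonneg_left (he q hq) hs
    have h2 := mul_le_mul_of_nonneg_left (he' q hq) ht
    have h3 : inner ℝ q.1 q.2 = s * inner ℝ q.1 q.2 + t * inner ℝ q.1 q.2 := by
      rw [← add_mul, hst, one_mul]
    simp only [hF, Prod.fst_add, Prod.snd_add, Prod.smul_fst, Prod.smul_snd, smul_eq_mul,
      WithLp.add_fst, WithLp.add_snd, WithLp.smul_fst, WithLp.smul_snd, inner_add_left,
      inner_add_right, real_inner_smul_left, real_inner_smul_right] at h1 h2 ⊢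
    linarith
  -- If this failed, `e.1` would be monotonically related to all of `A`, hence in `A`; testing `F`
  -- at that very point is contradictory.
  have hFge : ∀ e ∈ E, inner ℝ e.1.fst e.1.snd ≤ e.2 := by
    intro e he
    by_contra! hlt
    have hmem : (e.1.fst, e.1.snd) ∈ A := by
      refine hmax _ fun q hq => ?_
      have := he q hq
      simp only [hF] at this
      simp only [inner_sub_left, inner_sub_right]
      linarith
    have := he _ hmem
    simp only [hF] at this
    linarith
  have hnorm : ∀ h : WithLp 2 (X × X), ‖h‖ ^ 2 = ‖h.fst‖ ^ 2 + ‖h.snd‖ ^ 2 :=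
    fun h => WithLp.prod_norm_sq_eq_of_L2 h
  obtain ⟨e, he, hmin⟩ := exists_forall_sub_inner_le hEne hEcl hEco (by
    intro e he
    have h1 := hFge e he
    have h2 := norm_add_sq_real e.1.fst e.1.snd
    rw [hnorm]
    nlinarith [sq_nonneg ‖e.1.fst + e.1.snd‖])
  -- First-order condition at the minimizer, tested on the points of the epigraph that come from
  -- `A`. It puts `(-e.1.snd, -e.1.fst)` in `A`; taking `q` to be this point forces `e.1.fst +
  -- e.1.snd = 0`.
  have hle : ∀ q ∈ A, ‖e.1.fst + e.1.snd‖ ^ 2 ≤ inner ℝ (-e.1.snd - q.1) (-e.1.fst - q.2) := by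
    intro q hq
    have h1 := hmin _ (hself q hq)
    have h2 := hFge e he
    simp only [inner_sub_right, WithLp.prod_inner_apply, real_inner_self_eq_norm_sq] at h1
    have h4 := hnorm e.1
    have h5 := norm_add_sq_real e.1.fst e.1.snd
    simp only [inner_sub_left, inner_sub_right, inner_neg_left, inner_neg_right]
    change e.2 - (inner ℝ e.1.fst q.1 + inner ℝ e.1.snd q.2 -
      (‖e.1.fst‖ ^ 2 + ‖e.1.snd‖ ^ 2)) ≤ inner ℝ q.1 q.2 at h1
    rw [real_inner_comm e.1.fst e.1.snd, real_inner_comm e.1.fst q.1]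
    linarith
  have hmem : (-e.1.snd, -e.1.fst) ∈ A := hmax _ fun q hq => (sq_nonneg _).trans (hle q hq)
  have h0 := hle _ hmem
  simp only [sub_self, inner_zero_left] at h0
  have h1 : e.1.fst + e.1.snd = 0 := by
    rw [← norm_eq_zero]
    exact pow_eq_zero_iff two_ne_zero |>.1 (le_antisymm h0 (sq_nonneg _))
  refine ⟨-e.1.snd, ?_⟩
  rwa [eq_neg_of_add_eq_zero_left h1] at hmem

/-- Minty's theorem. -/
theorem IsMaximallyMonotone.exists_mem_add_smul_eq [CompleteSpace X] {A : SetRel X X}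
    (hA : IsMaximallyMonotone A) {l : ℝ} (hl : 0 < l) (u : X) :
    ∃ p q, (p, q) ∈ A ∧ q + l • p = u := by
  obtain ⟨a, b, hab⟩ := hA.nonempty
  -- The rescaled operator `p ↦ l⁻¹ (A p - u)` is again maximally monotone.
  obtain ⟨x, hx⟩ := exists_neg_mem_of_maximal (A := {p : X × X | (p.1, l • p.2 + u) ∈ A})
    ⟨(a, l⁻¹ • (b - u)), by simpa [hl.ne'] using hab⟩
    (fun p hp q hq => by
      have h := hA.prop _ _ _ _ hp hq
      rw [add_sub_add_right_eq_sub, ← smul_sub, real_inner_smul_right] at h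
      exact nonneg_of_mul_nonneg_right h hl)
    (fun p hp => hA.mem_of_forall_nonneg fun y w hyw => by
      have h := hp (y, l⁻¹ • (w - u)) (by simpa [hl.ne'] using hyw)
      have e : l • p.2 + u - w = l • (p.2 - l⁻¹ • (w - u)) := by
        rw [smul_sub, smul_inv_smul₀ hl.ne']; abel
      rw [e, real_inner_smul_right]
      exact mul_nonneg hl.le h)
  exact ⟨x, _, hx, by simp⟩

theorem IsMaximallyMonotone.resolvent_mem [CompleteSpace X] {A : SetRel X X}
    (hA : IsMaximallyMonotone A) (x : X) : (resolvent A x, x - resolvent A x) ∈ A := by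
  obtain ⟨p, q, hpq, h⟩ := hA.exists_mem_add_smul_eq one_pos x
  have hp : (p, x - p) ∈ A := by
    rwa [← h, one_smul, add_sub_cancel_right]
  rwa [resolvent_eq hA.prop hp]

theorem IsMaximallyMonotone.resolvent_inv [CompleteSpace X] {A : SetRel X X}
    (hA : IsMaximallyMonotone A) (x : X) : resolvent A.inv x = x - resolvent A x := by
  refine resolvent_eq (IsMonotone.inv hA.prop) ?_
  rw [sub_sub_cancel]
  exact hA.resolvent_mem x

/-! ### Closures of ranges: convexity and recession directions. -/

/-- If `(y, u)` has finite Fitzpatrick value, then `u` lies in the closure of the range. -/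
theorem IsMaximallyMonotone.mem_closure_cod [CompleteSpace X] {A : SetRel X X}
    (hA : IsMaximallyMonotone A) {y u : X} {C : ℝ}
    (h : ∀ p q, (p, q) ∈ A → inner ℝ (p - y) (u - q) ≤ C) : u ∈ closure A.cod := by
  have hs : ∀ n : ℕ, ∃ p q, (p, q) ∈ A ∧ q + (1 / ((n : ℝ) + 1)) • p = u :=
    fun n => hA.exists_mem_add_smul_eq Nat.one_div_pos_of_nat u
  choose p q hpq hs using hs
  refine mem_closure_of_tendsto (f := q) (b := atTop) ?_ (Eventually.of_forall fun n => ⟨_, hpq n⟩)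
  rw [tendsto_iff_norm_sub_tendsto_zero]
  -- With `l = 1 / (n + 1)`, the hypothesis bounds `l * ‖p n‖ ^ 2`, so `‖q n - u‖ = l * ‖p n‖` is of
  -- order `√l`.
  have hbound : ∀ n : ℕ, ‖q n - u‖ ≤ √((1 / ((n : ℝ) + 1)) * (‖y‖ ^ 2 + 2 * |C|)) := by
    intro n
    have hl := Nat.one_div_pos_of_nat (α := ℝ) (n := n)
    have hl1 : 1 / ((n : ℝ) + 1) ≤ 1 := by
      simpa using Nat.one_div_le_one_div (α := ℝ) (Nat.zero_le n)
    have hn := hs n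
    set l := 1 / ((n : ℝ) + 1)
    refine Real.le_sqrt_of_sq_le ?_
    have e1 : q n - u = -(l • p n) := by rw [← hn]; abel
    have e2 : u - q n = l • p n := by rw [← hn]; abel
    have h1 := h _ _ (hpq n)
    rw [e2, real_inner_smul_right, inner_sub_left, real_inner_self_eq_norm_sq] at h1
    rw [e1, norm_neg, norm_smul, Real.norm_of_nonneg hl.le, mul_pow]
    have h2 := real_inner_le_norm y (p n)
    have h3 := le_abs_self C
    have h4 : l * ‖p n‖ ^ 2 ≤ l * ‖y‖ ^ 2 + 2 * |C| := by
      have h5 : 2 * inner ℝ y (p n) ≤ ‖y‖ ^ 2 + ‖p n‖ ^ 2 := by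
        nlinarith [sq_nonneg (‖y‖ - ‖p n‖)]
      have := mul_le_mul_of_nonneg_left h5 hl.le
      linarith
    have h6 := mul_le_mul_of_nonneg_left h4 hl.le
    have h7 : l * ‖y‖ ^ 2 ≤ ‖y‖ ^ 2 := mul_le_of_le_one_left (sq_nonneg _) hl1
    have h8 := mul_le_mul_of_nonneg_left h7 hl.le
    linarith
  refine squeeze_zero (fun n => norm_nonneg _) hbound ?_
  simpa using
    ((tendsto_one_div_add_atTop_nhds_zero_nat (𝕜 := ℝ)).mul_const (‖y‖ ^ 2 + 2 * |C|)).sqrt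

theorem convex_closure_of_forall_mem_closure {S : Set X}
    (h : ∀ u ∈ S, ∀ v ∈ S, ∀ s t : ℝ, 0 ≤ s → 0 ≤ t → s + t = 1 → s • u + t • v ∈ closure S) :
    Convex ℝ (closure S) := by
  intro u hu v hv s t hs ht hst
  have hc : Continuous fun p : X × X => s • p.1 + t • p.2 := by fun_prop
  have := map_mem_closure (t := closure S) hc
    (show (u, v) ∈ closure (S ×ˢ S) by rw [closure_prod_eq]; exact ⟨hu, hv⟩)
    (fun p hp => h _ hp.1 _ hp.2 s t hs ht hst)
  rwa [closure_closure] at this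

theorem IsMaximallyMonotone.convex_closure_cod [CompleteSpace X] {A : SetRel X X}
    (hA : IsMaximallyMonotone A) : Convex ℝ (closure A.cod) := by
  refine convex_closure_of_forall_mem_closure ?_
  rintro u ⟨y, hyu⟩ v ⟨z, hzv⟩ s t hs ht hst
  -- The constant is what remains when the monotonicity inequalities against `(y, u)` and `(z, v)`
  -- are averaged with weights `s` and `t`.
  refine hA.mem_closure_cod (y := s • y + t • z)
    (C := s * inner ℝ y u + t * inner ℝ z v - inner ℝ (s • y + t • z) (s • u + t • v))
    fun p q hpq => ?_
  have h1 := mul_nonneg hs (hA.prop _ _ _ _ hpq hyu)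
  have h2 := mul_nonneg ht (hA.prop _ _ _ _ hpq hzv)
  have h3 : inner ℝ p q = s * inner ℝ p q + t * inner ℝ p q := by rw [← add_mul, hst, one_mul]
  simp only [inner_sub_left, inner_sub_right, inner_add_left, inner_add_right,
    real_inner_smul_left, real_inner_smul_right] at h1 h2 ⊢
  linarith

/-- The negative of a direction bounded below on the domain is a recession direction of the
closure of the range. -/
theorem IsMaximallyMonotone.sub_mem_closure_cod [CompleteSpace X] {A : SetRel X X}
    (hA : IsMaximallyMonotone A) {w : X} {c : ℝ} (hw : ∀ p ∈ A.dom, c ≤ inner ℝ w p)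
    {u : X} (hu : u ∈ A.cod) : u - w ∈ closure A.cod := by
  obtain ⟨y, hyu⟩ := hu
  refine hA.mem_closure_cod (y := y) (C := inner ℝ w y - c) fun p q hpq => ?_
  have h1 := hA.prop _ _ _ _ hpq hyu
  have h2 := hw p ⟨q, hpq⟩
  simp only [inner_sub_left, inner_sub_right] at h1 h2 ⊢
  linarith [real_inner_comm p w, real_inner_comm y w]

theorem metricProj_zero_spec [CompleteSpace X] {C : Set X} (hne : C.Nonempty) (hcl : IsClosed C)
    (hco : Convex ℝ C) :
    metricProj C 0 ∈ C ∧ ∀ y ∈ C, ‖metricProj C 0‖ ^ 2 ≤ inner ℝ (metricProj C 0) y := by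
  obtain ⟨hmem, hmin⟩ := metricProj_spec hne hcl hco 0
  refine ⟨hmem, fun y hy => ?_⟩
  have : Nonempty C := hne.to_subtype
  have h := (norm_eq_iInf_iff_real_inner_le_zero hco hmem (u := 0)).1
    (le_antisymm (le_ciInf fun w => hmin _ w.2)
      (ciInf_le ⟨0, by rintro _ ⟨w, rfl⟩; exact norm_nonneg _⟩ (⟨_, hmem⟩ : C))) y hy
  rw [zero_sub, inner_neg_left, inner_sub_right, real_inner_self_eq_norm_sq] at h
  linarith

theorem add_mem_closure_add {E : Type*} [NormedAddCommGroup E] {S S' : Set E} {a b : E}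
    (ha : a ∈ closure S) (hb : b ∈ closure S') : a + b ∈ closure (S + S') :=
  map_mem_closure₂ continuous_add ha hb fun _ h _ h' => Set.add_mem_add h h'

theorem sub_mem_closure_sub {E : Type*} [NormedAddCommGroup E] {S S' : Set E} {a b : E}
    (ha : a ∈ closure S) (hb : b ∈ closure S') : a - b ∈ closure (S - S') :=
  map_mem_closure₂ continuous_sub ha hb fun _ h _ h' => Set.sub_mem_sub h h'

theorem convex_closure_add {S S' : Set X} (h : Convex ℝ (closure S))
    (h' : Convex ℝ (closure S')) : Convex ℝ (closure (S + S')) := by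
  refine convex_closure_of_forall_mem_closure ?_
  rintro _ ⟨a, ha, b, hb, rfl⟩ _ ⟨c, hc, d, hd, rfl⟩ s t hs ht hst
  have e : s • (a + b) + t • (c + d) = (s • a + t • c) + (s • b + t • d) := by module
  simp only [e]
  exact add_mem_closure_add (h (subset_closure ha) (subset_closure hc) hs ht hst)
    (h' (subset_closure hb) (subset_closure hd) hs ht hst)

theorem convex_closure_sub {S S' : Set X} (h : Convex ℝ (closure S))
    (h' : Convex ℝ (closure S')) : Convex ℝ (closure (S - S')) := by
  refine convex_closure_of_forall_mem_closure ?_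
  rintro _ ⟨a, ha, b, hb, rfl⟩ _ ⟨c, hc, d, hd, rfl⟩ s t hs ht hst
  have e : s • (a - b) + t • (c - d) = (s • a + t • c) - (s • b + t • d) := by module
  simp only [e]
  exact sub_mem_closure_sub (h (subset_closure ha) (subset_closure hc) hs ht hst)
    (h' (subset_closure hb) (subset_closure hd) hs ht hst)

theorem add_mem_closure_of_forall {E : Type*} [NormedAddCommGroup E] {S : Set E} {w v : E}
    (h : ∀ u ∈ S, u + w ∈ closure S) (hv : v ∈ closure S) : v + w ∈ closure S := by
  have := map_mem_closure (t := closure S) (f := fun u => u + w) (by fun_prop) hv h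
  rwa [closure_closure] at this

/-! ### The vectors `v_D` and `v_R`. -/

section Pair

variable [CompleteSpace X] {A B : SetRel X X}

theorem vD_spec (hA : IsMaximallyMonotone A) (hB : IsMaximallyMonotone B) :
    vD A B ∈ closure (domDiff A B) ∧
      ∀ y ∈ closure (domDiff A B), ‖vD A B‖ ^ 2 ≤ inner ℝ (vD A B) y := by
  obtain ⟨a, a', ha⟩ := hA.nonempty
  obtain ⟨b, b', hb⟩ := hB.nonempty
  exact metricProj_zero_spec ⟨a - b, subset_closure (Set.sub_mem_sub ⟨_, ha⟩ ⟨_, hb⟩)⟩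
    isClosed_closure (convex_closure_sub hA.inv.convex_closure_cod hB.inv.convex_closure_cod)

theorem vR_spec (hA : IsMaximallyMonotone A) (hB : IsMaximallyMonotone B) :
    vR A B ∈ closure (ranSum A B) ∧
      ∀ y ∈ closure (ranSum A B), ‖vR A B‖ ^ 2 ≤ inner ℝ (vR A B) y := by
  obtain ⟨a, a', ha⟩ := hA.nonempty
  obtain ⟨b, b', hb⟩ := hB.nonempty
  exact metricProj_zero_spec ⟨a' + b', subset_closure (Set.add_mem_add ⟨_, ha⟩ ⟨_, hb⟩)⟩
    isClosed_closure (convex_closure_add hA.convex_closure_cod hB.convex_closure_cod)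

/-- For a fixed `a ∈ dom A`, the minimality of `v_D` bounds `⟪-v_D, ·⟫` below on `dom B`, so `v_D`
is a recession direction of `closure (ran B)`. -/
theorem vR_add_vD_mem_closure_ranSum (hA : IsMaximallyMonotone A) (hB : IsMaximallyMonotone B) :
    vR A B + vD A B ∈ closure (ranSum A B) := by
  obtain ⟨a, a', ha⟩ := hA.nonempty
  refine add_mem_closure_of_forall ?_ (vR_spec hA hB).1
  rintro _ ⟨u, hu, w, hw, rfl⟩
  have h : w - -vD A B ∈ closure B.cod := by
    refine hB.sub_mem_closure_cod (c := ‖vD A B‖ ^ 2 - inner ℝ (vD A B) a) (fun b hb => ?_) hw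
    have := (vD_spec hA hB).2 _ (subset_closure (Set.sub_mem_sub ⟨a', ha⟩ hb))
    rw [inner_sub_right] at this
    rw [inner_neg_left]
    linarith
  rw [sub_neg_eq_add] at h
  simp only [add_assoc]
  exact add_mem_closure_add (subset_closure hu) h

/-- Here a point of `dom B` is fixed, and `-v_D` is a recession direction of `closure (ran A)`. -/
theorem vR_sub_vD_mem_closure_ranSum (hA : IsMaximallyMonotone A) (hB : IsMaximallyMonotone B) :
    vR A B - vD A B ∈ closure (ranSum A B) := by
  obtain ⟨b, b', hb⟩ := hB.nonempty
  rw [sub_eq_add_neg]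
  refine add_mem_closure_of_forall ?_ (vR_spec hA hB).1
  rintro _ ⟨u, hu, w, hw, rfl⟩
  have h : u - vD A B ∈ closure A.cod := by
    refine hA.sub_mem_closure_cod (c := ‖vD A B‖ ^ 2 + inner ℝ (vD A B) b) (fun a ha => ?_) hu
    have := (vD_spec hA hB).2 _ (subset_closure (Set.sub_mem_sub ha ⟨b', hb⟩))
    rw [inner_sub_right] at this
    linarith
  have e : u + w + -vD A B = (u - vD A B) + w := by abel
  simp only [e]
  exact add_mem_closure_add h (subset_closure hw)

/-- The same argument for `B.inv`, with domains and ranges exchanged. -/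
theorem vR_add_vD_mem_closure_domDiff (hA : IsMaximallyMonotone A) (hB : IsMaximallyMonotone B) :
    vR A B + vD A B ∈ closure (domDiff A B) := by
  obtain ⟨a, a', ha⟩ := hA.nonempty
  rw [add_comm]
  refine add_mem_closure_of_forall ?_ (vD_spec hA hB).1
  rintro _ ⟨u, hu, w, hw, rfl⟩
  have h : w - vR A B ∈ closure B.dom := by
    refine hB.inv.sub_mem_closure_cod (c := ‖vR A B‖ ^ 2 - inner ℝ (vR A B) a')
      (fun b hb => ?_) hw
    have := (vR_spec hA hB).2 _ (subset_closure (Set.add_mem_add ⟨a, ha⟩ hb))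
    rw [inner_add_right] at this
    linarith
  have e : u - w + vR A B = u - (w - vR A B) := by abel
  simp only [e]
  exact sub_mem_closure_sub (subset_closure hu) h

/-- Minimality of `v_R` against `v_R + v_D` and `v_R - v_D` gives the two opposite inequalities. -/
theorem inner_vR_vD (hA : IsMaximallyMonotone A) (hB : IsMaximallyMonotone B) :
    inner ℝ (vR A B) (vD A B) = 0 := by
  have h1 := (vR_spec hA hB).2 _ (vR_add_vD_mem_closure_ranSum hA hB)
  have h2 := (vR_spec hA hB).2 _ (vR_sub_vD_mem_closure_ranSum hA hB)
  rw [inner_add_right, real_inner_self_eq_norm_sq] at h1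
  rw [inner_sub_right, real_inner_self_eq_norm_sq] at h2
  linarith

end Pair

/-! ### Asymptotics of firmly nonexpansive iterations. -/

/-- For a firmly nonexpansive `T`, the differences `T^n x - T^(n+1) x` converge to the element of
minimal norm of the closure of the range of `Id - T`. -/
theorem tendsto_iterate_sub_iterate_succ {T : X → X}
    (hT : ∀ x y, 0 ≤ inner ℝ (T x - T y) ((x - T x) - (y - T y))) {v : X}
    (hv : v ∈ closure (Set.range fun x => x - T x))
    (hmin : ∀ x, ‖v‖ ^ 2 ≤ inner ℝ v (x - T x)) (x : X) :
    Tendsto (fun n => T^[n] x - T^[n + 1] x) atTop (𝓝 v) := by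
  have hfirm : ∀ x y, ‖T x - T y‖ ^ 2 + ‖(x - T x) - (y - T y)‖ ^ 2 ≤ ‖x - y‖ ^ 2 := by
    intro x y
    have h := norm_add_sq_real (T x - T y) ((x - T x) - (y - T y))
    have e : (T x - T y) + ((x - T x) - (y - T y)) = x - y := by abel
    rw [e] at h
    linarith [hT x y]
  have hne : ∀ x y, ‖T x - T y‖ ^ 2 ≤ ‖x - y‖ ^ 2 := fun x y => by
    linarith [hfirm x y, sq_nonneg ‖(x - T x) - (y - T y)‖]
  have hdec : ∀ x y, Antitone fun n => ‖T^[n] x - T^[n] y‖ ^ 2 := fun x y =>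
    antitone_nat_of_succ_le fun n => by
      simp only [Function.iterate_succ_apply']
      exact hne _ _
  -- The squared gap between the displacements of two orbits is at most the drop of the convergent
  -- sequence `‖T^[n] x - T^[n] y‖ ^ 2`.
  have hdiff : ∀ y, Tendsto (fun n => ‖(T^[n] x - T^[n + 1] x) - (T^[n] y - T^[n + 1] y)‖ ^ 2)
      atTop (𝓝 0) := by
    intro y
    have hlim := tendsto_atTop_ciInf (hdec x y) ⟨0, by rintro _ ⟨n, rfl⟩; positivity⟩
    have hlim' := hlim.sub (hlim.comp (tendsto_add_atTop_nat 1))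
    rw [sub_self] at hlim'
    refine squeeze_zero (fun n => sq_nonneg _) (fun n => ?_) hlim'
    have := hfirm (T^[n] x) (T^[n] y)
    simp only [Function.comp_apply, Function.iterate_succ_apply']
    linarith
  -- Displacements along an orbit do not grow in norm, so a start `y` of nearly minimal displacement
  -- keeps all of them near `v`. The orbit of `x` is then compared with that of `y`.
  have hle : ∀ y n, ‖(T^[n] y - T^[n + 1] y) - v‖ ^ 2 ≤ ‖y - T y‖ ^ 2 - ‖v‖ ^ 2 := by
    intro y n
    have h1 : ‖T^[n] y - T^[n + 1] y‖ ^ 2 ≤ ‖y - T y‖ ^ 2 := hdec y (T y) (Nat.zero_le n)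
    have h2 := hmin (T^[n] y)
    rw [← Function.iterate_succ_apply' T] at h2
    rw [norm_sub_sq_real, real_inner_comm]
    linarith
  rw [Metric.tendsto_atTop]
  intro ε hε
  have hnhds : ∀ᶠ w in 𝓝 v, ‖w‖ ^ 2 - ‖v‖ ^ 2 < (ε / 2) ^ 2 := by
    have hc : Continuous fun w : X => ‖w‖ ^ 2 - ‖v‖ ^ 2 := by fun_prop
    refine hc.continuousAt.eventually_lt continuousAt_const ?_
    rw [sub_self]
    positivity
  obtain ⟨_, hy, y, rfl⟩ := mem_closure_iff_nhds.1 hv _ hnhds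
  have hsq : (0 : ℝ) < (ε / 2) ^ 2 := by positivity
  obtain ⟨N, hN⟩ := eventually_atTop.1 ((hdiff y).eventually_lt_const hsq)
  refine ⟨N, fun n hn => ?_⟩
  have h1 := lt_of_pow_lt_pow_left₀ 2 (by positivity) (hN n hn)
  have h2 := lt_of_pow_lt_pow_left₀ 2 (by positivity) ((hle y n).trans_lt hy)
  rw [dist_eq_norm]
  have h3 := norm_sub_le_norm_sub_add_norm_sub (T^[n] x - T^[n + 1] x)
    (T^[n] y - T^[n + 1] y) v
  linarith

/-- Since `c` bounds all cross differences and is attained in the limit on the diagonal, the bounds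
at `(n, n + 1)` and `(n + 1, n)` squeeze the increment. -/
theorem tendsto_inner_sub_succ {w : X} {c : ℝ} {a b : ℕ → X}
    (h : ∀ n m, c ≤ inner ℝ w (a n - b m))
    (hlim : Tendsto (fun n => inner ℝ w (a n - b n)) atTop (𝓝 c)) :
    Tendsto (fun n => inner ℝ w (a n - a (n + 1))) atTop (𝓝 0) := by
  have h1 : Tendsto (fun n => inner ℝ w (a n - b n) - c) atTop (𝓝 0) := by
    simpa using hlim.sub_const c
  have h2 := (h1.comp (tendsto_add_atTop_nat 1)).neg
  rw [neg_zero] at h2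
  refine tendsto_of_tendsto_of_tendsto_of_le_of_le h2 h1 (fun n => ?_) (fun n => ?_)
  · have := h n (n + 1)
    simp only [Function.comp_apply, inner_sub_right] at this ⊢
    linarith
  · have := h (n + 1) n
    simp only [inner_sub_right] at this ⊢
    linarith

/-- Firm nonexpansiveness of `T` is read off from that of `J_A` and `J_B`. The exact identity also
bounds the `A`-term alone by the left side, which the shadow sequences need. -/
theorem inner_drOperator_sub (A B : SetRel X X) (x y : X) :
    inner ℝ (drOperator A B x - drOperator A B y)
        ((x - drOperator A B x) - (y - drOperator A B y)) =
      inner ℝ (resolvent A x - resolvent A y) ((x - resolvent A x) - (y - resolvent A y)) +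
      inner ℝ (resolvent B (reflectedResolvent A x) - resolvent B (reflectedResolvent A y))
        ((reflectedResolvent A x - resolvent B (reflectedResolvent A x)) -
          (reflectedResolvent A y - resolvent B (reflectedResolvent A y))) := by
  simp only [drOperator, reflectedResolvent]
  generalize resolvent B _ = b
  generalize resolvent B _ = b'
  generalize resolvent A x = a
  generalize resolvent A y = a'
  have e1 : x - a + b - (y - a' + b') = (x - y) - (a - a') + (b - b') := by abel
  have e2 : x - (x - a + b) - (y - (y - a' + b')) = (a - a') - (b - b') := by abel
  have e3 : x - a - (y - a') = (x - y) - (a - a') := by abel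
  have e4 : (2 : ℝ) • a - x - b - ((2 : ℝ) • a' - y - b') =
      (2 : ℝ) • (a - a') - (x - y) - (b - b') := by module
  rw [e1, e2, e3, e4]
  generalize a - a' = p
  generalize b - b' = r
  generalize x - y = q
  simp only [inner_sub_left, inner_sub_right, inner_add_left, real_inner_smul_right]
  rw [real_inner_comm p r, real_inner_comm p q, real_inner_comm r q]
  ring

/-! ### Limits of the differences of the shadow sequences. -/

section Iterates

variable [CompleteSpace X] {A B : SetRel X X}

theorem IsMaximallyMonotone.inner_resolvent_sub_nonneg (hA : IsMaximallyMonotone A) (x y : X) :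
    0 ≤ inner ℝ (resolvent A x - resolvent A y) ((x - resolvent A x) - (y - resolvent A y)) :=
  hA.prop _ _ _ _ (hA.resolvent_mem x) (hA.resolvent_mem y)

theorem tendsto_drOperator_iterate_sub (hA : IsMaximallyMonotone A) (hB : IsMaximallyMonotone B)
    (hT : closure (Set.range fun x => x - drOperator A B x) =
      closure (domDiff A B) ∩ closure (ranSum A B)) (x : X) :
    Tendsto (fun n => (drOperator A B)^[n] x - (drOperator A B)^[n + 1] x) atTop
      (𝓝 (vR A B + vD A B)) := by
  refine tendsto_iterate_sub_iterate_succ (fun x y => ?_) ?_ (fun x => ?_) x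
  · rw [inner_drOperator_sub]
    exact add_nonneg (hA.inner_resolvent_sub_nonneg _ _) (hB.inner_resolvent_sub_nonneg _ _)
  · rw [hT]
    exact ⟨vR_add_vD_mem_closure_domDiff hA hB, vR_add_vD_mem_closure_ranSum hA hB⟩
  · have hx : x - drOperator A B x ∈ closure (domDiff A B) ∩ closure (ranSum A B) :=
      hT ▸ subset_closure ⟨x, rfl⟩
    have h1 := (vD_spec hA hB).2 _ hx.1
    have h2 := (vR_spec hA hB).2 _ hx.2
    rw [norm_add_sq_real, inner_vR_vD hA hB, inner_add_left]
    linarith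

/-- The differences of the two shadow sequences converge to `v_R` and `v_D`. -/
theorem tendsto_resolvent_iterate_sub (hA : IsMaximallyMonotone A) (hB : IsMaximallyMonotone B)
    (hT : closure (Set.range fun x => x - drOperator A B x) =
      closure (domDiff A B) ∩ closure (ranSum A B)) (x : X) :
    Tendsto (fun n => resolvent A ((drOperator A B)^[n] x) -
        resolvent A ((drOperator A B)^[n + 1] x)) atTop (𝓝 (vR A B)) ∧
      Tendsto (fun n => resolvent A.inv ((drOperator A B)^[n] x) -
        resolvent A.inv ((drOperator A B)^[n + 1] x)) atTop (𝓝 (vD A B)) := by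
  have hd := tendsto_drOperator_iterate_sub hA hB hT x
  simp only [hA.resolvent_inv]
  set z : ℕ → X := fun n => (drOperator A B)^[n] x with hz
  set a : ℕ → X := fun n => resolvent A (z n) with ha
  set b : ℕ → X := fun n => resolvent B (reflectedResolvent A (z n)) with hb
  have hzs : ∀ n, z (n + 1) = drOperator A B (z n) := fun n => Function.iterate_succ_apply' _ _ _
  have hab : ∀ n, a n - b n = z n - z (n + 1) := fun n => by
    rw [hzs]; simp only [drOperator, ha, hb]; abel
  change Tendsto (fun n => z n - z (n + 1)) atTop _ at hd
  change Tendsto (fun n => a n - a (n + 1)) atTop _ ∧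
    Tendsto (fun n => (z n - a n) - (z (n + 1) - a (n + 1))) atTop _
  have hRD := inner_vR_vD hA hB
  have hDR : inner ℝ (vD A B) (vR A B) = 0 := by rw [real_inner_comm, hRD]
  have haA : ∀ n, (a n, z n - a n) ∈ A := fun n => hA.resolvent_mem _
  have hbB : ∀ n, (b n, reflectedResolvent A (z n) - b n) ∈ B := fun n => hB.resolvent_mem _
  have hdD : Tendsto (fun n => inner ℝ (vD A B) (z n - z (n + 1))) atTop (𝓝 (‖vD A B‖ ^ 2)) := by
    have := (tendsto_const_nhds (x := vD A B)).inner (𝕜 := ℝ) hd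
    rwa [inner_add_right, hDR, zero_add, real_inner_self_eq_norm_sq] at this
  have hdR : Tendsto (fun n => inner ℝ (vR A B) (z n - z (n + 1))) atTop (𝓝 (‖vR A B‖ ^ 2)) := by
    have := (tendsto_const_nhds (x := vR A B)).inner (𝕜 := ℝ) hd
    rwa [inner_add_right, hRD, add_zero, real_inner_self_eq_norm_sq] at this
  have hDa : Tendsto (fun n => inner ℝ (vD A B) (a n - a (n + 1))) atTop (𝓝 0) := by
    refine tendsto_inner_sub_succ (b := b) (fun n m => ?_) (by simpa only [hab] using hdD)
    exact (vD_spec hA hB).2 _ (subset_closure (Set.sub_mem_sub ⟨_, haA n⟩ ⟨_, hbB m⟩))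
  have hRa : Tendsto (fun n => inner ℝ (vR A B) ((z n - a n) - (z (n + 1) - a (n + 1))))
      atTop (𝓝 0) := by
    -- The elements of `ran A` and `ran B` given by the two resolvents add up to `(z n - a n) + (R_A
    -- (z n) - b n) = a n - b n`.
    refine tendsto_inner_sub_succ (c := ‖vR A B‖ ^ 2) (a := fun n => z n - a n)
      (b := fun n => -(reflectedResolvent A (z n) - b n)) (fun n m => ?_) ?_
    · rw [sub_neg_eq_add]
      exact (vR_spec hA hB).2 _ (subset_closure (Set.add_mem_add ⟨_, haA n⟩ ⟨_, hbB m⟩))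
    · refine hdR.congr fun n => ?_
      rw [← hab]
      congr 1
      simp only [reflectedResolvent, ha]
      module
  -- Monotonicity of `A` bounds this below by `0`. Above, it is at most `⟪d (n + 1), d n - d (n +
  -- 1)⟫` with `d n = z n - z (n + 1)`, which tends to `0` because `d` converges.
  have hinner : Tendsto (fun n => inner ℝ (a n - a (n + 1))
      ((z n - a n) - (z (n + 1) - a (n + 1)))) atTop (𝓝 0) := by
    have hd1 := hd.comp (tendsto_add_atTop_nat 1)
    have hlim := hd1.inner (𝕜 := ℝ) (hd.sub hd1)
    rw [sub_self, inner_zero_right] at hlim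
    refine squeeze_zero (fun n => hA.inner_resolvent_sub_nonneg _ _) (fun n => ?_) hlim
    have h1 := inner_drOperator_sub A B (z n) (z (n + 1))
    have h2 := hB.inner_resolvent_sub_nonneg (reflectedResolvent A (z n))
      (reflectedResolvent A (z (n + 1)))
    rw [← hzs, ← hzs] at h1
    simp only [Function.comp_apply]
    rw [h1]
    exact le_add_of_nonneg_right h2
  have hsum : Tendsto (fun n => ‖(a n - a (n + 1)) - vR A B‖ ^ 2 +
      ‖((z n - a n) - (z (n + 1) - a (n + 1))) - vD A B‖ ^ 2) atTop (𝓝 0) := by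
    have hlim := ((((hd.norm.pow 2).sub (hinner.const_mul 2)).sub ((hdR.sub hRa).const_mul 2)).sub
      ((hdD.sub hDa).const_mul 2)).add_const (‖vR A B‖ ^ 2 + ‖vD A B‖ ^ 2)
    have e : ‖vR A B + vD A B‖ ^ 2 - 2 * 0 - 2 * (‖vR A B‖ ^ 2 - 0) - 2 * (‖vD A B‖ ^ 2 - 0) +
        (‖vR A B‖ ^ 2 + ‖vD A B‖ ^ 2) = 0 := by
      rw [norm_add_sq_real, hRD]; ring
    rw [e] at hlim
    refine hlim.congr fun n => ?_
    have e1 : z n - z (n + 1) =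
        (a n - a (n + 1)) + ((z n - a n) - (z (n + 1) - a (n + 1))) := by abel
    rw [e1]
    generalize a n - a (n + 1) = p
    generalize (z n - a n) - (z (n + 1) - a (n + 1)) = s
    rw [norm_sub_sq_real, norm_sub_sq_real, norm_add_sq_real]
    simp only [inner_add_right]
    rw [real_inner_comm p (vR A B), real_inner_comm s (vD A B)]
    ring
  constructor
  · rw [tendsto_iff_norm_sub_tendsto_zero]
    have := (squeeze_zero (fun n => sq_nonneg _)
      (fun n => le_add_of_nonneg_right (sq_nonneg _)) hsum).sqrt
    simpa using this
  · rw [tendsto_iff_norm_sub_tendsto_zero]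
    have := (squeeze_zero (fun n => sq_nonneg _)
      (fun n => le_add_of_nonneg_left (sq_nonneg _)) hsum).sqrt
    simpa using this

end Iterates

end

end DouglasRachford

theorem mainTheorem6 {X : Type*} [NormedAddCommGroup X] [InnerProductSpace ℝ X] [CompleteSpace X]
    (A B : SetRel X X)
    (hA : DouglasRachford.IsMaximallyMonotone A) (hB : DouglasRachford.IsMaximallyMonotone B)
    (hT : closure (Set.range fun x => x - DouglasRachford.drOperator A B x) =
      closure (DouglasRachford.domDiff A B ∩ DouglasRachford.ranSum A B))
    (hDR : closure (DouglasRachford.domDiff A B ∩ DouglasRachford.ranSum A B) =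
      closure (DouglasRachford.domDiff A B) ∩ closure (DouglasRachford.ranSum A B))
    (x : X) :
    (DouglasRachford.AsymptoticallyRegular
        (fun n => DouglasRachford.resolvent A ((DouglasRachford.drOperator A B)^[n] x)) ↔
      DouglasRachford.vR A B = 0) ∧
    (DouglasRachford.AsymptoticallyRegular
        (fun n => DouglasRachford.resolvent A.inv ((DouglasRachford.drOperator A B)^[n] x)) ↔
      DouglasRachford.vD A B = 0) := by
  rw [hDR] at hT
  obtain ⟨h1, h2⟩ := DouglasRachford.tendsto_resolvent_iterate_sub hA hB hT x
  exact ⟨⟨fun h => tendsto_nhds_unique h1 h, fun h => by rwa [h] at h1⟩,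
    ⟨fun h => tendsto_nhds_unique h2 h, fun h => by rwa [h] at h2⟩⟩
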